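/- Let $n,p\ge 0$, $\hat A\in\mathbb C^{n\times n}$, $\hat B\in\mathbb C^{n\times p}$, $\hat C\in\mathbb C^{p\times n}$ with $\operatorname{rank}\hat B=\operatorname{rank}\hat C$, and let $G(s)=\hat C(sI_n-\hat A)^{-1}\hat B$, a $p\times p$ matrix-valued rational function (the realization is not assumed minimal). Put $G^{\#}(s):=G(-\bar s)^{*}$. A rational function is called analytic on $i\mathbb R$ if all its entries are analytic at every point of $i\mathbb R$ (after removing removable singularities). (a) The following are equivalent: - there is a static output feedback gain $K\in\mathbb C^{p\times p}$ such that the closed loop system $(I_p-GK)^{-1}G$ is analytic on $i\mathbb R$; - there is $K\in\mathbb C^{p\times p}$ with $-K$ Hermitian positive semidefinite such that the closed loop system $(I_p-GG^{\#}K)^{-1}GG^{\#}$ is analytic on $i\mathbb R$. (b) The same holds on the level of the state space realizations of the two closed loop systems. That is, the following are equivalent: - there is $K\in\mathbb C^{p\times p}$ such that $\hat A+\hat BK\hat C$ has no eigenvalue on $i\mathbb R$; - there is $K\in\mathbb C^{p\times p}$ with $-K$ Hermitian positive semidefinite such that the matrix $$\begin{pmatrix}\hat A&\hat B\hat B^{*}\\0&-\hat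 A^{*}\end{pmatrix}+\begin{pmatrix}0\\-\hat C^{*}\end{pmatrix}K\begin{pmatrix}\hat C&0\end{pmatrix}=\begin{pmatrix}\hat A&\hat B\hat B^{*}\\-\hat C^{*}K\hat C&-\hat A^{*}\end{pmatrix}$$ has no eigenvalue on $i\mathbb R$. -/

import Mathlib

open Polynomial Matrix Topology
open scoped ComplexOrder

noncomputable section

/-- The ring homomorphism `q ↦ q#` of `ℂ[X]`, where `q#(s) = conj (q (-conj s))`: conjugate the
coefficients and substitute `-X` for `X`. -/
def polySharp : ℂ[X] →+* ℂ[X] :=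
  (Polynomial.compRingHom (-X)).comp (Polynomial.mapRingHom (starRingEnd ℂ))

theorem polySharp_eval (q : ℂ[X]) (s : ℂ) :
    (polySharp q).eval s = starRingEnd ℂ (q.eval (-starRingEnd ℂ s)) := by
  induction q using Polynomial.induction_on' with
  | add a b ha hb => simp [ha, hb]
  | monomial k a => simp [polySharp]

theorem polySharp_injective : Function.Injective polySharp := by
  intro a b h
  refine Polynomial.funext fun z => ?_
  have := congrArg (fun q : ℂ[X] => q.eval (-starRingEnd ℂ z)) h
  exact (starRingEnd ℂ).injective (by simpa [polySharp_eval] using this)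

/-- The involution `f ↦ f#`, `f#(s) = conj (f (-conj s))`, of the field of scalar rational
functions. -/
def ratSharp : RatFunc ℂ →+* RatFunc ℂ :=
  RatFunc.mapRingHom polySharp
    (nonZeroDivisors_le_comap_nonZeroDivisors_of_injective polySharp polySharp_injective)

/-- `F#(s) = F(-s*)*` for a matrix-valued rational function `F`. -/
def ratMatrixSharp {p m : ℕ} (F : Matrix (Fin p) (Fin m) (RatFunc ℂ)) :
    Matrix (Fin m) (Fin p) (RatFunc ℂ) :=
  (F.map ratSharp)ᵀ

/-- A constant matrix, viewed as a matrix-valued rational function. -/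
def constMatrix {p m : ℕ} (M : Matrix (Fin p) (Fin m) ℂ) :
    Matrix (Fin p) (Fin m) (RatFunc ℂ) :=
  M.map RatFunc.C

/-- The rational function `C (s I - A)⁻¹ B`; the inverse is taken over the field of rational
functions, where `det (s I - A)` is never zero. -/
def transferFunction {n p m : ℕ} (A : Matrix (Fin n) (Fin n) ℂ) (B : Matrix (Fin n) (Fin m) ℂ)
    (C : Matrix (Fin p) (Fin n) ℂ) : Matrix (Fin p) (Fin m) (RatFunc ℂ) :=
  constMatrix C * ((RatFunc.X : RatFunc ℂ) • (1 : Matrix (Fin n) (Fin n) (RatFunc ℂ))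
    - constMatrix A)⁻¹ * constMatrix B

/-- The closed loop system `(I - F K)⁻¹ F` obtained from `F` by the static output feedback `K`.
The inverse is genuine whenever `F` vanishes at infinity, since `det (I - F K)` is then `1` at
infinity. -/
def closedLoop {p m : ℕ} (F : Matrix (Fin p) (Fin m) (RatFunc ℂ)) (K : Matrix (Fin m) (Fin p) ℂ) :
    Matrix (Fin p) (Fin m) (RatFunc ℂ) :=
  (1 - F * constMatrix K)⁻¹ * F

/-- A matrix-valued rational function is analytic at every point of the imaginary axis (after
removing removable singularities, as usual for rational functions). -/
def IsAnalyticOnImagAxis {p m : ℕ} (F : Matrix (Fin p) (Fin m) (RatFunc ℂ)) : Prop :=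
  ∀ (ω : ℝ) (i : Fin p) (j : Fin m), ∃ g : ℂ → ℂ, AnalyticAt ℂ g ((ω : ℂ) * Complex.I) ∧
    ∀ᶠ s in 𝓝[≠] ((ω : ℂ) * Complex.I), RatFunc.eval (RingHom.id ℂ) s (F i j) = g s

/-- The square matrix `M` has no eigenvalue on the imaginary axis. -/
def NoImagSpectrum {ι : Type*} [Fintype ι] [DecidableEq ι] (M : Matrix ι ι ℂ) : Prop :=
  ∀ ω : ℝ, (ω : ℂ) * Complex.I ∉ spectrum ℂ M

/-- The state matrix of the realization
`A₂ = [A, B Bᴴ; 0, -Aᴴ]`, `B₂ = [0; -Cᴴ]`, `C₂ = [C, 0]` of `G G#`, where `G = C (s I - A)⁻¹ B`,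
after the static output feedback `K`, that is `A₂ + B₂ K C₂`. -/
def evenClosedLoopState {n p m : ℕ} (A : Matrix (Fin n) (Fin n) ℂ) (B : Matrix (Fin n) (Fin m) ℂ)
    (C : Matrix (Fin p) (Fin n) ℂ) (K : Matrix (Fin p) (Fin p) ℂ) :
    Matrix (Fin n ⊕ Fin n) (Fin n ⊕ Fin n) ℂ :=
  fromBlocks A (B * Bᴴ) 0 (-Aᴴ) +
    fromRows (0 : Matrix (Fin n) (Fin p) ℂ) (-Cᴴ) * K *
      fromCols C (0 : Matrix (Fin p) (Fin n) ℂ)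

end

/-! In (a) both sides always hold. For `G`, let `f` be the monic gcd of all closed loop
characteristic polynomials. Its roots are the modes no gain can move, and for a generic gain the
cofactor has no imaginary root (`exists_gain_no_imaginary_root`). Each entry of the closed loop is
one minus a quotient of two such characteristic polynomials (`closedLoop_apply_eq`), so `f` cancels.
For `G G#` the gain `-I` works: on the imaginary axis `G G#` is `G Gᴴ`, so `(I + G Gᴴ)⁻¹` is bounded
there, and a rational function bounded on the axis has no pole on it.

In (b) `f` no longer cancels. With the gain `-I`, an imaginary eigenvalue of the even closed loop
comes from an unobservable or uncontrollable mode of `A`, and such a mode survives every feedback.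
Conversely, if the even system can be freed of imaginary eigenvalues, `A` has no such mode on the
axis. Then no imaginary point is a root of `f` (`exists_gain_det_ne_zero`), and the generic gain
works again. -/

noncomputable section

/-! ### Fixed modes and generic output feedback -/

/-- The characteristic polynomials of the matrices `A + B K C` have a monic greatest common
divisor, and no point is a root of all the quotients by it. -/
theorem exists_monic_gcd_charpoly_feedback {n p : ℕ} (A : Matrix (Fin n) (Fin n) ℂ)
    (B : Matrix (Fin n) (Fin p) ℂ) (C : Matrix (Fin p) (Fin n) ℂ) :
    ∃ f : ℂ[X], f.Monic ∧ (∀ K : Matrix (Fin p) (Fin p) ℂ, f ∣ (A + B * K * C).charpoly) ∧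
      ∀ z, ∃ K : Matrix (Fin p) (Fin p) ℂ, ((A + B * K * C).charpoly /ₘ f).eval z ≠ 0 := by
  set S : Set ℂ[X] := Set.range fun K : Matrix (Fin p) (Fin p) ℂ => (A + B * K * C).charpoly
  obtain ⟨g, hg⟩ := (IsPrincipalIdealRing.principal (Ideal.span S)).principal
  rw [← Ideal.span] at hg
  have hg0 : g ≠ 0 := by
    rintro rfl
    have h : (A + B * (0 : Matrix (Fin p) (Fin p) ℂ) * C).charpoly ∈ Ideal.span S :=
      Ideal.subset_span ⟨0, rfl⟩
    rw [hg] at h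
    have h' : (A + B * (0 : Matrix (Fin p) (Fin p) ℂ) * C).charpoly = 0 := by simpa using h
    exact (charpoly_monic _).ne_zero h'
  set f := normalize g with hf
  have hfm : f.Monic := Polynomial.monic_normalize hg0
  have hS : Ideal.span S = Ideal.span {f} := by
    rw [hg, Ideal.span_singleton_eq_span_singleton]
    exact (normalize_associated g).symm
  have hdvd : ∀ K : Matrix (Fin p) (Fin p) ℂ, f ∣ (A + B * K * C).charpoly := fun K => by
    rw [← Ideal.mem_span_singleton, ← hS]
    exact Ideal.subset_span ⟨K, rfl⟩
  refine ⟨f, hfm, hdvd, fun z => ?_⟩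
  by_contra! h
  -- A common root `z` of all quotients would make `f * (X - z)` a common divisor of larger degree.
  have hle : Ideal.span {f} ≤ Ideal.span {f * (X - Polynomial.C z)} := by
    rw [← hS, Ideal.span_le]
    rintro _ ⟨K, rfl⟩
    obtain ⟨q, hq⟩ := hdvd K
    have hz := h K
    rw [hq, mul_divByMonic_cancel_left _ hfm] at hz
    rw [SetLike.mem_coe, Ideal.mem_span_singleton]
    change _ ∣ (A + B * K * C).charpoly
    rw [hq]
    exact mul_dvd_mul_left _ (dvd_iff_isRoot.2 hz)
  rw [Ideal.span_singleton_le_span_singleton] at hle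
  have := Polynomial.degree_le_of_dvd hle hfm.ne_zero
  rw [degree_mul, degree_X_sub_C, degree_eq_natDegree hfm.ne_zero] at this
  have h2 : f.natDegree + 1 ≤ f.natDegree := by exact_mod_cast this
  omega

theorem map_map_evalRingHom_add_X_smul {m k : ℕ} (M D : Matrix (Fin m) (Fin k) ℂ) (x : ℂ) :
    (M.map Polynomial.C + (X : ℂ[X]) • D.map Polynomial.C).map (evalRingHom x) = M + x • D := by
  ext i j; simp [mul_comm x]

/-- Along a line of gains, the quotients of the characteristic polynomials by a fixed monic
polynomial depend polynomially on the parameter. -/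
theorem exists_bivariate_charpoly_divByMonic {n : ℕ} (M D : Matrix (Fin n) (Fin n) ℂ) {f : ℂ[X]}
    (hf : f.Monic) :
    ∃ Q : ℂ[X][X], ∀ x, Q.map (evalRingHom x) = (M + x • D).charpoly /ₘ f := by
  refine ⟨(M.map Polynomial.C + (X : ℂ[X]) • D.map Polynomial.C).charpoly /ₘ
    f.map Polynomial.C, fun x => ?_⟩
  rw [map_divByMonic _ (hf.map _), ← charpoly_map, map_map_evalRingHom_add_X_smul,
    Polynomial.map_map]
  have hid : (evalRingHom x).comp Polynomial.C = RingHom.id ℂ := RingHom.ext fun a => by simp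
  rw [hid, Polynomial.map_id]

theorem exists_polynomial_eval_charpoly_divByMonic {n : ℕ} (M D : Matrix (Fin n) (Fin n) ℂ)
    {f : ℂ[X]} (hf : f.Monic) (z : ℂ) :
    ∃ q : ℂ[X], ∀ x, q.eval x = ((M + x • D).charpoly /ₘ f).eval z := by
  obtain ⟨Q, hQ⟩ := exists_bivariate_charpoly_divByMonic M D hf
  refine ⟨Q.eval (Polynomial.C z), fun x => ?_⟩
  rw [← hQ, ← coe_evalRingHom x, ← Polynomial.eval₂_id, Polynomial.hom_eval₂, eval_map]
  simp

theorem exists_polynomial_det_aeval_charpoly_divByMonic {n : ℕ}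
    (M D N E : Matrix (Fin n) (Fin n) ℂ) {f : ℂ[X]} (hf : f.Monic) :
    ∃ q : ℂ[X], ∀ x, q.eval x = (aeval (N + x • E) ((M + x • D).charpoly /ₘ f)).det := by
  obtain ⟨Q, hQ⟩ := exists_bivariate_charpoly_divByMonic M D hf
  refine ⟨(aeval (N.map Polynomial.C + (X : ℂ[X]) • E.map Polynomial.C) Q).det, fun x => ?_⟩
  rw [← hQ, ← coe_evalRingHom x, RingHom.map_det, aeval_def, Polynomial.hom_eval₂,
    RingHom.mapMatrix_apply, map_map_evalRingHom_add_X_smul, aeval_def, eval₂_map]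
  congr 2
  ext a i j
  · simp [Matrix.algebraMap_matrix_apply]; split_ifs <;> simp
  · simp [Matrix.algebraMap_matrix_apply]; split_ifs <;> simp

/-- Points are added one at a time along the line through the old gain (parameter 0) and one suited
to the new point (parameter 1). Each condition is a nonzero polynomial in the parameter, hence so is
their product. -/
theorem exists_gain_eval_divByMonic_ne_zero {n p : ℕ} {A : Matrix (Fin n) (Fin n) ℂ}
    {B : Matrix (Fin n) (Fin p) ℂ} {C : Matrix (Fin p) (Fin n) ℂ} {f : ℂ[X]} (hf : f.Monic)
    (h : ∀ z, ∃ K : Matrix (Fin p) (Fin p) ℂ, ((A + B * K * C).charpoly /ₘ f).eval z ≠ 0)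
    (s : Finset ℂ) :
    ∃ K : Matrix (Fin p) (Fin p) ℂ, ∀ z ∈ s, ((A + B * K * C).charpoly /ₘ f).eval z ≠ 0 := by
  induction s using Finset.induction_on with
  | empty => simp
  | insert a s ha ih =>
    obtain ⟨K, hK⟩ := ih
    obtain ⟨L, hL⟩ := h a
    choose q hq using fun z => exists_polynomial_eval_charpoly_divByMonic
      (A + B * K * C) (B * (L - K) * C) hf z
    have hq' : ∀ z x, (q z).eval x =
        ((A + B * (K + x • (L - K)) * C).charpoly /ₘ f).eval z := fun z x => by
      rw [hq]
      simp only [Matrix.mul_add, Matrix.add_mul, Matrix.mul_smul, Matrix.smul_mul, add_assoc]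
    have hne : q a * ∏ z ∈ s, q z ≠ 0 := by
      refine mul_ne_zero (fun h0 => ?_) (Finset.prod_ne_zero_iff.2 fun z hz h0 => ?_)
      · have := hq' a 1
        rw [h0, one_smul, add_sub_cancel] at this
        exact hL (by simpa using this.symm)
      · have := hq' z 0
        rw [h0, zero_smul, add_zero] at this
        exact hK z hz (by simpa using this.symm)
    obtain ⟨x, hx⟩ : ∃ x, (q a * ∏ z ∈ s, q z).eval x ≠ 0 := by
      by_contra! h0
      exact hne (Polynomial.funext (by simpa using h0))
    rw [eval_mul, eval_prod, mul_ne_zero_iff, Finset.prod_ne_zero_iff] at hx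
    refine ⟨K + x • (L - K), fun z hz => ?_⟩
    rw [← hq']
    rcases Finset.mem_insert.1 hz with rfl | hz
    · exact hx.1
    · exact hx.2 z hz

/-- The determinant plays the role of a resultant: it detects a common root of `q` and the
characteristic polynomial of `M`, polynomially in the data. -/
theorem det_aeval_eq_zero_iff {n : ℕ} (M : Matrix (Fin n) (Fin n) ℂ) (q : ℂ[X]) :
    (aeval M q).det = 0 ↔ ∃ z ∈ spectrum ℂ M, q.eval z = 0 := by
  have h0 : (aeval M q).det = 0 ↔ 0 ∈ spectrum ℂ (aeval M q) := by
    rw [spectrum.zero_mem_iff, isUnit_iff_isUnit_det, isUnit_iff_ne_zero, not_not]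
  rw [h0]
  rcases Nat.eq_zero_or_pos n with rfl | hn
  · simp
  · have : NeZero n := ⟨hn.ne'⟩
    rw [spectrum.map_polynomial_aeval_of_nonempty _ _
      (spectrum.nonempty_of_isAlgClosed_of_finiteDimensional ℂ M)]
    simp

/-- A function of two variables that is polynomial on every complex line and vanishes on the
graph of complex conjugation is zero. -/
theorem eq_zero_of_polynomial_on_lines {R : ℂ → ℂ → ℂ}
    (hR : ∀ a b c d, ∃ q : ℂ[X], ∀ x, q.eval x = R (a + x * b) (c + x * d))
    (h : ∀ t, R t (starRingEnd ℂ t) = 0) (t u : ℂ) : R t u = 0 := by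
  have key : ∀ q : ℂ[X], (∀ x : ℝ, q.eval (x : ℂ) = 0) → ∀ x, q.eval x = 0 := by
    intro q hq x
    have : q = 0 := Polynomial.eq_zero_of_infinite_isRoot q
      ((Set.infinite_range_of_injective Complex.ofReal_injective).mono
        (by rintro _ ⟨x, rfl⟩; exact hq x))
    simp [this]
  -- In the coordinates `t = x + iy`, `u = x - iy` the graph of conjugation is the set of real `x`,
  -- `y`. The zeros extend to complex `x`, and then to complex `y`.
  have h1 : ∀ (y : ℝ) (x : ℂ), R (y * Complex.I + x * 1) (-(y * Complex.I) + x * 1) = 0 := by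
    intro y x
    obtain ⟨q, hq⟩ := hR (y * Complex.I) 1 (-(y * Complex.I)) 1
    rw [← hq]
    refine key q (fun x => ?_) x
    rw [hq]
    simpa [mul_comm, neg_mul] using h (y * Complex.I + x * 1)
  have h2 : ∀ x y : ℂ, R (x + y * Complex.I) (x + y * -Complex.I) = 0 := by
    intro x y
    obtain ⟨q, hq⟩ := hR x Complex.I x (-Complex.I)
    rw [← hq]
    refine key q (fun y => ?_) y
    rw [hq]
    convert h1 y x using 1
    congr 1 <;> ring
  convert h2 ((t + u) / 2) ((t - u) / (2 * Complex.I)) using 1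
  congr 1 <;> field_simp <;> ring

/-- The reflection `z ↦ -conj z` fixes the imaginary axis pointwise. -/
theorem spectrum_neg_conjTranspose {n : ℕ} {M : Matrix (Fin n) (Fin n) ℂ} {ω : ℝ}
    (h : (ω : ℂ) * Complex.I ∈ spectrum ℂ M) : (ω : ℂ) * Complex.I ∈ spectrum ℂ (-Mᴴ) := by
  have h1 : star ((ω : ℂ) * Complex.I) ∈ spectrum ℂ (star M) := by
    rw [spectrum.map_star]; simpa using h
  rw [← spectrum.neg_eq, Set.mem_neg]
  simpa [star_eq_conjTranspose] using h1

/-- Generic output feedback moves every eigenvalue that is not fixed off the imaginary axis. -/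
theorem exists_gain_no_imaginary_root {n p : ℕ} {A : Matrix (Fin n) (Fin n) ℂ}
    {B : Matrix (Fin n) (Fin p) ℂ} {C : Matrix (Fin p) (Fin n) ℂ} {f : ℂ[X]} (hf : f.Monic)
    (hdvd : ∀ K : Matrix (Fin p) (Fin p) ℂ, f ∣ (A + B * K * C).charpoly)
    (h : ∀ z, ∃ K : Matrix (Fin p) (Fin p) ℂ, ((A + B * K * C).charpoly /ₘ f).eval z ≠ 0) :
    ∃ K : Matrix (Fin p) (Fin p) ℂ, ∀ ω : ℝ,
      ((A + B * K * C).charpoly /ₘ f).eval (ω * Complex.I) ≠ 0 := by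
  have hfin : (spectrum ℂ (-Aᴴ)).Finite := Matrix.finite_spectrum _
  obtain ⟨K, hK⟩ := exists_gain_eval_divByMonic_ne_zero hf h hfin.toFinset
  set D := B * K * C
  -- `u` stands for `conj t` but varies independently, which makes `R` polynomial. An imaginary root
  -- of the quotient for the gain `t • K` is also an eigenvalue of `-(A + t • D)ᴴ`, so it forces `R
  -- t (conj t) = 0`.
  set R : ℂ → ℂ → ℂ := fun t u =>
    (aeval (-Aᴴ + u • -Dᴴ) ((A + t • D).charpoly /ₘ f)).det with hRdef
  have hR : ∀ a b c d, ∃ q : ℂ[X], ∀ x, q.eval x = R (a + x * b) (c + x * d) := by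
    intro a b c d
    obtain ⟨q, hq⟩ := exists_polynomial_det_aeval_charpoly_divByMonic
      (A + a • D) (b • D) (-Aᴴ + c • -Dᴴ) (d • -Dᴴ) hf
    refine ⟨q, fun x => ?_⟩
    rw [hq, hRdef]
    simp only [add_smul, mul_smul, add_assoc]
  -- At `(1, 0)` this says that the quotient for `K` avoids the spectrum of `-Aᴴ`, which is how `K`
  -- was chosen.
  have hne : R 1 0 ≠ 0 := by
    rw [hRdef, Ne, det_aeval_eq_zero_iff]
    rintro ⟨z, hz, hz0⟩
    rw [zero_smul, add_zero] at hz
    rw [one_smul] at hz0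
    exact hK z (by simpa using hz) hz0
  obtain ⟨t, ht⟩ : ∃ t, R t (starRingEnd ℂ t) ≠ 0 := by
    by_contra! h0
    exact hne (eq_zero_of_polynomial_on_lines hR h0 1 0)
  have hD : B * (t • K) * C = t • D := by simp [D]
  refine ⟨t • K, fun ω hω => ht ?_⟩
  rw [hD] at hω
  rw [hRdef, det_aeval_eq_zero_iff]
  refine ⟨ω * Complex.I, ?_, hω⟩
  have hroot : (ω : ℂ) * Complex.I ∈ spectrum ℂ (A + t • D) := by
    rw [mem_spectrum_iff_isRoot_charpoly]
    obtain ⟨q, hq⟩ := hdvd (t • K)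
    rw [hD] at hq
    rw [hq, mul_divByMonic_cancel_left _ hf] at hω
    rw [hq, IsRoot, eval_mul, hω, mul_zero]
  convert spectrum_neg_conjTranspose hroot using 2
  rw [conjTranspose_add, conjTranspose_smul, neg_add, smul_neg]
  rfl

/-! ### Poles of rational functions on the imaginary axis -/

theorem exists_analyticAt_eval_of_denom_ne_zero {r : RatFunc ℂ} {z : ℂ}
    (h : r.denom.eval z ≠ 0) :
    ∃ g : ℂ → ℂ, AnalyticAt ℂ g z ∧ ∀ᶠ s in 𝓝[≠] z, RatFunc.eval (RingHom.id ℂ) s r = g s := by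
  refine ⟨fun s => r.num.eval s / r.denom.eval s, ?_, Filter.Eventually.of_forall fun s => rfl⟩
  exact (r.num.differentiable.analyticAt z).div (r.denom.differentiable.analyticAt z) h

/-- A quotient of polynomials that is bounded on the imaginary axis has no pole there. -/
theorem denom_div_eval_ne_zero_of_bounded {a b : ℂ[X]} (hb : b ≠ 0) (c : ℝ)
    (h : ∀ ω : ℝ, ‖a.eval (ω * Complex.I)‖ ≤ c * ‖b.eval (ω * Complex.I)‖) (ω : ℝ) :
    (algebraMap ℂ[X] (RatFunc ℂ) a / algebraMap ℂ[X] (RatFunc ℂ) b).denom.eval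
      (ω * Complex.I) ≠ 0 := by
  set r := algebraMap ℂ[X] (RatFunc ℂ) a / algebraMap ℂ[X] (RatFunc ℂ) b with hr
  have hmul : r.num * b = a * r.denom := (RatFunc.num_mul_eq_mul_denom_iff hb).2 hr
  have hinj : Function.Injective fun ω : ℝ => (ω : ℂ) * Complex.I := fun x y hxy => by
    simpa using hxy
  have hfin : {ω : ℝ | b.eval (ω * Complex.I) = 0}.Finite :=
    (Polynomial.finite_setOfPred_isRoot hb).preimage hinj.injOn
  have hclosed : IsClosed {ω : ℝ | ‖r.num.eval (ω * Complex.I)‖ ≤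
      c * ‖r.denom.eval (ω * Complex.I)‖} := by
    refine isClosed_le ?_ ?_ <;> fun_prop
  have hsub : {ω : ℝ | b.eval (ω * Complex.I) = 0}ᶜ ⊆ {ω : ℝ | ‖r.num.eval (ω * Complex.I)‖ ≤
      c * ‖r.denom.eval (ω * Complex.I)‖} := by
    intro x hx
    have h1 := congrArg (fun q : ℂ[X] => ‖q.eval (x * Complex.I)‖) hmul
    simp only [eval_mul, norm_mul] at h1
    have h2 : 0 < ‖b.eval (x * Complex.I)‖ := norm_pos_iff.2 hx
    refine le_of_mul_le_mul_right ?_ h2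
    calc _ = _ := h1
      _ ≤ c * ‖b.eval (x * Complex.I)‖ * ‖r.denom.eval (x * Complex.I)‖ := by gcongr; exact h x
      _ = _ := by ring
  -- The bound for the reduced fraction extends by density across the finitely many zeros of `b`. A
  -- zero of the denominator would then be one of the numerator, against coprimality.
  have hall : ‖r.num.eval (ω * Complex.I)‖ ≤ c * ‖r.denom.eval (ω * Complex.I)‖ := by
    have hd : Dense ({ω : ℝ | b.eval (ω * Complex.I) = 0}ᶜ) :=
      hfin.countable.dense_compl ℝ
    exact (hclosed.closure_subset_iff.2 hsub) (hd ω)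
  intro h0
  rw [h0, norm_zero, mul_zero, norm_le_zero_iff] at hall
  obtain ⟨u, v, huv⟩ := r.isCoprime_num_denom
  have := congrArg (Polynomial.eval ((ω : ℂ) * Complex.I)) huv
  simp [h0, hall] at this

/-! ### Closed loop entries as quotients of characteristic polynomials -/

theorem constMatrix_add {p m : ℕ} (M N : Matrix (Fin p) (Fin m) ℂ) :
    constMatrix (M + N) = constMatrix M + constMatrix N := by
  ext; simp [constMatrix]

theorem constMatrix_mul {p m k : ℕ} (M : Matrix (Fin p) (Fin m) ℂ) (N : Matrix (Fin m) (Fin k) ℂ) :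
    constMatrix (M * N) = constMatrix M * constMatrix N := by
  simp [constMatrix, Matrix.map_mul]

theorem X_smul_one_sub_constMatrix {n : ℕ} (M : Matrix (Fin n) (Fin n) ℂ) :
    (RatFunc.X : RatFunc ℂ) • (1 : Matrix (Fin n) (Fin n) (RatFunc ℂ)) - constMatrix M =
      (charmatrix M).map (algebraMap ℂ[X] (RatFunc ℂ)) := by
  ext i j
  rcases eq_or_ne i j with rfl | hij
  · simp [constMatrix]
  · simp [constMatrix, hij]

theorem det_X_smul_one_sub_constMatrix {n : ℕ} (M : Matrix (Fin n) (Fin n) ℂ) :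
    ((RatFunc.X : RatFunc ℂ) • (1 : Matrix (Fin n) (Fin n) (RatFunc ℂ)) - constMatrix M).det =
      algebraMap ℂ[X] (RatFunc ℂ) M.charpoly := by
  rw [X_smul_one_sub_constMatrix, charpoly, RingHom.map_det, RingHom.mapMatrix_apply]

theorem algebraMap_charpoly_ne_zero {n : ℕ} (M : Matrix (Fin n) (Fin n) ℂ) :
    algebraMap ℂ[X] (RatFunc ℂ) M.charpoly ≠ 0 :=
  RatFunc.algebraMap_ne_zero (charpoly_monic M).ne_zero

/-- `det (I - XY) = det (I - YX)` moves the determinant to the state space, where multiplying by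
`det (sI - A)` clears the resolvent. -/
theorem det_one_sub_transferFunction_mul {n p : ℕ} (A : Matrix (Fin n) (Fin n) ℂ)
    (B : Matrix (Fin n) (Fin p) ℂ) (C : Matrix (Fin p) (Fin n) ℂ) (K : Matrix (Fin p) (Fin p) ℂ) :
    (1 - transferFunction A B C * constMatrix K).det =
      algebraMap ℂ[X] (RatFunc ℂ) (A + B * K * C).charpoly /
        algebraMap ℂ[X] (RatFunc ℂ) A.charpoly := by
  have hA := algebraMap_charpoly_ne_zero A
  rw [eq_div_iff hA, ← det_X_smul_one_sub_constMatrix, ← det_X_smul_one_sub_constMatrix,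
    constMatrix_add, constMatrix_mul, constMatrix_mul, transferFunction]
  rw [← det_X_smul_one_sub_constMatrix] at hA
  set S := (RatFunc.X : RatFunc ℂ) • (1 : Matrix (Fin n) (Fin n) (RatFunc ℂ)) - constMatrix A
    with hS
  have hu : IsUnit S.det := isUnit_iff_ne_zero.2 hA
  rw [Matrix.mul_assoc, Matrix.mul_assoc, det_one_sub_mul_comm, mul_comm, ← det_mul,
    Matrix.mul_sub, Matrix.mul_one, ← Matrix.mul_assoc, ← Matrix.mul_assoc, ← Matrix.mul_assoc,
    mul_nonsing_inv _ hu, Matrix.one_mul, hS, sub_sub]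

/-- Adding the matrix unit at `(j, i)` to the gain multiplies `I - F K` by a rank-one perturbation
of the identity, whose determinant reads off one entry of the closed loop. -/
theorem closedLoop_apply_eq {p : ℕ} (F : Matrix (Fin p) (Fin p) (RatFunc ℂ))
    (K : Matrix (Fin p) (Fin p) ℂ) (h : (1 - F * constMatrix K).det ≠ 0) (i j : Fin p) :
    closedLoop F K i j =
      1 - (1 - F * constMatrix (K + vecMulVec (Pi.single j 1) (Pi.single i 1))).det /
        (1 - F * constMatrix K).det := by
  have hu : IsUnit (1 - F * constMatrix K).det := isUnit_iff_ne_zero.2 h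
  have hE : constMatrix (vecMulVec (Pi.single j 1) (Pi.single i 1) : Matrix (Fin p) (Fin p) ℂ) =
      vecMulVec (Pi.single j 1) (Pi.single i 1) := by
    ext k l
    by_cases hk : k = j <;> by_cases hl : l = i <;>
      simp [constMatrix, vecMulVec_apply, hk, hl]
  have hfac : 1 - F * constMatrix (K + vecMulVec (Pi.single j 1) (Pi.single i 1)) =
      (1 - F * constMatrix K) *
        (1 - closedLoop F K * vecMulVec (Pi.single j 1) (Pi.single i 1)) := by
    rw [Matrix.mul_sub, Matrix.mul_one, closedLoop, ← Matrix.mul_assoc, ← Matrix.mul_assoc,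
      mul_nonsing_inv _ hu, Matrix.one_mul, constMatrix_add, Matrix.mul_add, hE, sub_sub]
  have hdet : (1 - closedLoop F K * vecMulVec (Pi.single j 1) (Pi.single i 1)).det =
      1 - closedLoop F K i j := by
    rw [mul_vecMulVec, vecMulVec_eq Unit, det_one_sub_mul_comm, det_unique]
    simp [mul_apply, Pi.single_apply]
  rw [hfac, det_mul, mul_div_cancel_left₀ _ h, hdet, sub_sub_cancel]

/-- Every transfer function can be made analytic on the imaginary axis by output feedback. -/
theorem exists_isAnalyticOnImagAxis_closedLoop {n p : ℕ} (A : Matrix (Fin n) (Fin n) ℂ)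
    (B : Matrix (Fin n) (Fin p) ℂ) (C : Matrix (Fin p) (Fin n) ℂ) :
    ∃ K : Matrix (Fin p) (Fin p) ℂ,
      IsAnalyticOnImagAxis (closedLoop (transferFunction A B C) K) := by
  obtain ⟨f, hf, hdvd, hz⟩ := exists_monic_gcd_charpoly_feedback A B C
  obtain ⟨K, hK⟩ := exists_gain_no_imaginary_root hf hdvd hz
  refine ⟨K, fun ω i j => exists_analyticAt_eval_of_denom_ne_zero ?_⟩
  have hA := algebraMap_charpoly_ne_zero A
  have hP := algebraMap_charpoly_ne_zero (A + B * K * C)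
  rw [closedLoop_apply_eq _ _ (by
      rw [det_one_sub_transferFunction_mul]; exact div_ne_zero hP hA),
    det_one_sub_transferFunction_mul, det_one_sub_transferFunction_mul,
    div_div_div_cancel_right₀ hA]
  -- The fixed factor `f` cancels, leaving the denominator `b`, which has no imaginary root.
  obtain ⟨a, ha⟩ := hdvd (K + vecMulVec (Pi.single j 1) (Pi.single i 1))
  obtain ⟨b, hb⟩ := hdvd K
  have hKω := hK ω
  rw [hb, mul_divByMonic_cancel_left _ hf] at hKω
  have hf0 := RatFunc.algebraMap_ne_zero hf.ne_zero
  have hb0 : b ≠ 0 := by rintro rfl; simp at hKω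
  rw [ha, hb, map_mul, map_mul, mul_div_mul_left _ _ hf0,
    one_sub_div (RatFunc.algebraMap_ne_zero hb0), ← map_sub]
  intro h0
  obtain ⟨q, hq⟩ := RatFunc.denom_div_dvd (b - a) b
  rw [hq, eval_mul, h0, zero_mul] at hKω
  exact hKω rfl

/-! ### The product `G G#` under the gain `-I` -/

theorem star_dotProduct_self {p : ℕ} (v : Fin p → ℂ) :
    star v ⬝ᵥ v = ((∑ k, ‖v k‖ ^ 2 : ℝ) : ℂ) := by
  simp [dotProduct, Complex.conj_mul']

theorem star_dotProduct_mul_conjTranspose_mulVec {p m : ℕ} (Q : Matrix (Fin p) (Fin m) ℂ)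
    (v : Fin p → ℂ) :
    star v ⬝ᵥ (Q * Qᴴ) *ᵥ v = ((∑ k, ‖(Qᴴ *ᵥ v) k‖ ^ 2 : ℝ) : ℂ) := by
  rw [← star_dotProduct_self, star_mulVec, conjTranspose_conjTranspose, ← mulVec_mulVec,
    dotProduct_mulVec]

/-- The entries of `δ (δ I + Q Qᴴ)⁻¹`, freed of the denominator, are bounded by one. -/
theorem norm_mul_adjugate_apply_le_norm_det {p m : ℕ} {δ : ℝ} (hδ : 0 ≤ δ)
    (Q : Matrix (Fin p) (Fin m) ℂ) (i j : Fin p) :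
    ‖(δ : ℂ) * ((δ : ℂ) • (1 : Matrix (Fin p) (Fin p) ℂ) + Q * Qᴴ).adjugate i j‖ ≤
      ‖((δ : ℂ) • (1 : Matrix (Fin p) (Fin p) ℂ) + Q * Qᴴ).det‖ := by
  rcases hδ.eq_or_lt with rfl | hδ
  · simp
  set D := (δ : ℂ) • (1 : Matrix (Fin p) (Fin p) ℂ) + Q * Qᴴ with hD
  set v : Fin p → ℂ := (δ : ℂ) • (D.adjugate *ᵥ Pi.single j 1) with hv
  have hvi : (δ : ℂ) * D.adjugate i j = v i := by simp [hv]
  have hDv : D *ᵥ v = ((δ : ℂ) * D.det) • Pi.single j 1 := by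
    rw [hv, mulVec_smul, mulVec_mulVec, mul_adjugate, smul_mulVec, one_mulVec, smul_smul]
  have h1 : star v ⬝ᵥ D *ᵥ v = (δ : ℂ) * (D.det * star (v j)) := by
    rw [hDv]; simp [mul_assoc]
  have h2 : star v ⬝ᵥ D *ᵥ v =
      ((δ * ∑ k, ‖v k‖ ^ 2 + ∑ k, ‖(Qᴴ *ᵥ v) k‖ ^ 2 : ℝ) : ℂ) := by
    rw [hD, add_mulVec, dotProduct_add, star_dotProduct_mul_conjTranspose_mulVec, smul_mulVec,
      one_mulVec, dotProduct_smul, star_dotProduct_self]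
    simp
  -- Pairing `D v = δ det D • e_j` with `v` and dropping the nonnegative `Q Qᴴ` term. The entry `k =
  -- j` then bounds `v j`, and that bounds every entry.
  have h3 : δ * ∑ k, ‖v k‖ ^ 2 ≤ δ * (‖D.det‖ * ‖v j‖) := by
    have h4 := congrArg norm (h2.symm.trans h1)
    rw [Complex.norm_real, norm_mul, norm_mul, norm_star, Complex.norm_real,
      Real.norm_of_nonneg (by positivity), Real.norm_of_nonneg hδ.le] at h4
    rw [← h4]
    exact le_add_of_nonneg_right (by positivity)
  have h5 := le_of_mul_le_mul_left h3 hδ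
  have hk : ∀ k, ‖v k‖ ^ 2 ≤ ‖D.det‖ * ‖v j‖ := fun k =>
    (Finset.single_le_sum (f := fun k => ‖v k‖ ^ 2) (fun _ _ => by positivity)
      (Finset.mem_univ k)).trans h5
  have hj : ‖v j‖ ≤ ‖D.det‖ := by
    by_contra! h
    nlinarith [hk j, norm_nonneg D.det]
  rw [hvi]
  refine abs_le_of_sq_le_sq' ?_ (norm_nonneg _) |>.2
  nlinarith [hk i, norm_nonneg D.det]

theorem ratSharp_algebraMap (q : ℂ[X]) :
    ratSharp (algebraMap ℂ[X] (RatFunc ℂ) q) = algebraMap ℂ[X] (RatFunc ℂ) (polySharp q) := by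
  have h := RatFunc.map_apply_div_ne_zero polySharp
    (nonZeroDivisors_le_comap_nonZeroDivisors_of_injective polySharp polySharp_injective) q 1
    one_ne_zero
  simp only [map_one, div_one] at h
  exact h

theorem polySharp_eval_imaginary (q : ℂ[X]) (ω : ℝ) :
    (polySharp q).eval (ω * Complex.I) = star (q.eval (ω * Complex.I)) := by
  rw [polySharp_eval]; simp

theorem smul_one_map_ringHom {m : Type*} [DecidableEq m] {R S : Type*} [CommRing R] [CommRing S]
    (φ : R →+* S) (r : R) : (r • (1 : Matrix m m R)).map φ = φ r • 1 := by
  ext i j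
  by_cases hij : i = j <;> simp [hij]

/-- The polynomial numerator `C adj(s I - A) B` of `C (s I - A)⁻¹ B`. -/
def transferNumerator {n p m : ℕ} (A : Matrix (Fin n) (Fin n) ℂ) (B : Matrix (Fin n) (Fin m) ℂ)
    (C : Matrix (Fin p) (Fin n) ℂ) : Matrix (Fin p) (Fin m) ℂ[X] :=
  C.map Polynomial.C * (charmatrix A).adjugate * B.map Polynomial.C

theorem constMatrix_eq_map {p m : ℕ} (M : Matrix (Fin p) (Fin m) ℂ) :
    constMatrix M = (M.map Polynomial.C).map (algebraMap ℂ[X] (RatFunc ℂ)) := by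
  ext; simp [constMatrix]

theorem transferFunction_eq_smul_map {n p m : ℕ} (A : Matrix (Fin n) (Fin n) ℂ)
    (B : Matrix (Fin n) (Fin m) ℂ) (C : Matrix (Fin p) (Fin n) ℂ) :
    transferFunction A B C = (algebraMap ℂ[X] (RatFunc ℂ) A.charpoly)⁻¹ •
      (transferNumerator A B C).map (algebraMap ℂ[X] (RatFunc ℂ)) := by
  have hadj : ((charmatrix A).map (algebraMap ℂ[X] (RatFunc ℂ))).adjugate =
      (charmatrix A).adjugate.map (algebraMap ℂ[X] (RatFunc ℂ)) :=
    ((algebraMap ℂ[X] (RatFunc ℂ)).map_adjugate _).symm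
  rw [transferFunction, inv_def, det_X_smul_one_sub_constMatrix, X_smul_one_sub_constMatrix, hadj,
    Ring.inverse_eq_inv', constMatrix_eq_map, constMatrix_eq_map, transferNumerator,
    Matrix.map_mul, Matrix.map_mul, Matrix.mul_smul, Matrix.smul_mul]

/-- The gain `-I` makes `G G#` analytic on the imaginary axis. -/
theorem isAnalyticOnImagAxis_closedLoop_mul_sharp {n p : ℕ} (A : Matrix (Fin n) (Fin n) ℂ)
    (B : Matrix (Fin n) (Fin p) ℂ) (C : Matrix (Fin p) (Fin n) ℂ) :
    IsAnalyticOnImagAxis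
      (closedLoop (transferFunction A B C * ratMatrixSharp (transferFunction A B C))
        (-1 : Matrix (Fin p) (Fin p) ℂ)) := by
  set ι := algebraMap ℂ[X] (RatFunc ℂ)
  set N := transferNumerator A B C
  set e := A.charpoly * polySharp A.charpoly with he
  have hχ : A.charpoly ≠ 0 := (charpoly_monic A).ne_zero
  have he0 : e ≠ 0 :=
    mul_ne_zero hχ ((map_ne_zero_iff _ polySharp_injective).2 hχ)
  -- This is `I + G G#` cleared of denominators. At `iω` it equals `|χ|² I + N Nᴴ`, with `χ` the
  -- characteristic polynomial of `A`.
  set D : Matrix (Fin p) (Fin p) ℂ[X] := e • 1 + N * (N.map polySharp)ᵀ with hD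
  set F := transferFunction A B C * ratMatrixSharp (transferFunction A B C) with hF
  have hsharp : ratMatrixSharp (transferFunction A B C) =
      (ι (polySharp A.charpoly))⁻¹ • ((N.map polySharp)ᵀ).map ι := by
    ext i j
    simp [ratMatrixSharp, transferFunction_eq_smul_map, ratSharp_algebraMap, N, ι]
  have hmapD : D.map ι = ι e • (1 + F) := by
    have hFN : F = (ι e)⁻¹ • (N * (N.map polySharp)ᵀ).map ι := by
      rw [hF, hsharp, transferFunction_eq_smul_map, Matrix.map_mul, Matrix.smul_mul,
        Matrix.mul_smul, smul_smul, he, map_mul, mul_inv]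
    rw [hFN, smul_add, smul_inv_smul₀ (RatFunc.algebraMap_ne_zero he0), hD,
      Matrix.map_add _ (map_add ι), smul_one_map_ringHom]
  have hDeval : ∀ ω : ℝ, D.map (evalRingHom ((ω : ℂ) * Complex.I)) =
      ((‖A.charpoly.eval ((ω : ℂ) * Complex.I)‖ ^ 2 : ℝ) : ℂ) • 1 +
        N.map (evalRingHom ((ω : ℂ) * Complex.I)) *
          (N.map (evalRingHom ((ω : ℂ) * Complex.I)))ᴴ := by
    intro ω
    have h1 : ((N.map polySharp)ᵀ).map (evalRingHom ((ω : ℂ) * Complex.I)) =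
        (N.map (evalRingHom ((ω : ℂ) * Complex.I)))ᴴ := by
      ext i j
      simp [polySharp_eval_imaginary]
    rw [← h1, ← Matrix.map_mul, hD]
    ext i j
    by_cases hij : i = j <;>
      simp [hij, he, polySharp_eval_imaginary, Complex.mul_conj']
  have heval : ∀ ω : ℝ, e.eval ((ω : ℂ) * Complex.I) =
      ((‖A.charpoly.eval ((ω : ℂ) * Complex.I)‖ ^ 2 : ℝ) : ℂ) := fun ω => by
    simp [he, polySharp_eval_imaginary, Complex.mul_conj']
  have hdetEval : ∀ ω : ℝ, D.det.eval ((ω : ℂ) * Complex.I) =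
      (D.map (evalRingHom ((ω : ℂ) * Complex.I))).det := fun ω => by
    rw [← coe_evalRingHom, RingHom.map_det, RingHom.mapMatrix_apply]
  have hadjEval : ∀ (ω : ℝ) i j, (D.adjugate i j).eval ((ω : ℂ) * Complex.I) =
      (D.map (evalRingHom ((ω : ℂ) * Complex.I))).adjugate i j := fun ω i j => by
    rw [← RingHom.mapMatrix_apply, ← RingHom.map_adjugate]; simp
  have hbound : ∀ (i j) (ω : ℝ), ‖(e * D.adjugate i j).eval ((ω : ℂ) * Complex.I)‖ ≤
      ‖D.det.eval ((ω : ℂ) * Complex.I)‖ := fun i j ω => by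
    rw [eval_mul, heval, hdetEval, hadjEval, hDeval]
    exact norm_mul_adjugate_apply_le_norm_det (by positivity) _ i j
  have hdet0 : D.det ≠ 0 := by
    intro h0
    obtain ⟨ω, hω⟩ : ∃ ω : ℝ, A.charpoly.eval ((ω : ℂ) * Complex.I) ≠ 0 := by
      by_contra! h
      refine hχ (Polynomial.eq_zero_of_infinite_isRoot _ ((Set.infinite_range_of_injective
        (f := fun ω : ℝ => (ω : ℂ) * Complex.I) fun x y hxy => by simpa using hxy).mono ?_))
      rintro _ ⟨x, rfl⟩
      exact h x
    have hpos : ((((‖A.charpoly.eval ((ω : ℂ) * Complex.I)‖ ^ 2 : ℝ) : ℂ) •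
        (1 : Matrix (Fin p) (Fin p) ℂ)) + N.map (evalRingHom ((ω : ℂ) * Complex.I)) *
          (N.map (evalRingHom ((ω : ℂ) * Complex.I)))ᴴ).PosDef := by
      refine PosDef.add_posSemidef (PosDef.smul PosDef.one ?_)
        (posSemidef_self_mul_conjTranspose _)
      exact_mod_cast pow_pos (norm_pos_iff.2 hω) 2
    have := hdetEval ω
    rw [h0, hDeval, eval_zero] at this
    exact hpos.det_pos.ne this
  have hιe : ι e ≠ 0 := RatFunc.algebraMap_ne_zero he0
  have hιD : ι D.det ≠ 0 := RatFunc.algebraMap_ne_zero hdet0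
  have hinv : (1 + F)⁻¹ = (ι e / ι D.det) • D.adjugate.map ι := by
    refine inv_eq_right_inv ?_
    have h1 : (1 + F) = (ι e)⁻¹ • D.map ι := by rw [hmapD, inv_smul_smul₀ hιe]
    rw [h1, Matrix.smul_mul, Matrix.mul_smul, ← Matrix.map_mul, mul_adjugate, smul_smul,
      smul_one_map_ringHom, smul_smul]
    convert one_smul (RatFunc ℂ) _
    field_simp
  have hunit : IsUnit (1 + F).det := by
    refine isUnit_iff_ne_zero.2 fun h0 => hιD ?_
    have h1 : ι D.det = (D.map ι).det := by rw [RingHom.map_det, RingHom.mapMatrix_apply]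
    rw [h1, hmapD, det_smul, h0, mul_zero]
  -- `(I + F)⁻¹ F = I - (I + F)⁻¹`, so only the inverse needs a bound.
  have hT : closedLoop F (-1) = 1 - (1 + F)⁻¹ := by
    have hc : constMatrix (-1 : Matrix (Fin p) (Fin p) ℂ) = -1 := by
      ext i j; by_cases hij : i = j <;> simp [constMatrix, hij]
    rw [closedLoop, hc, Matrix.mul_neg, Matrix.mul_one, sub_neg_eq_add, eq_sub_iff_add_eq]
    nth_rewrite 2 [← Matrix.mul_one ((1 + F)⁻¹)]
    rw [← Matrix.mul_add, add_comm F 1, nonsing_inv_mul _ hunit]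
  intro ω i j
  refine exists_analyticAt_eval_of_denom_ne_zero ?_
  have hentry : closedLoop F (-1) i j =
      ι ((1 : Matrix (Fin p) (Fin p) ℂ[X]) i j * D.det - e * D.adjugate i j) / ι D.det := by
    rw [hT, hinv, Matrix.sub_apply, Matrix.smul_apply, map_apply, map_sub,
      map_mul ι (_ : ℂ[X]) D.det, map_mul ι e]
    have : ι ((1 : Matrix (Fin p) (Fin p) ℂ[X]) i j) =
        (1 : Matrix (Fin p) (Fin p) (RatFunc ℂ)) i j := by
      rw [one_apply, one_apply]
      split_ifs
      exacts [map_one ι, map_zero ι]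
    rw [this, sub_div, mul_div_cancel_right₀ _ hιD, smul_eq_mul, div_mul_eq_mul_div]
  rw [hentry]
  -- The bound 2 is 1 for the identity plus 1 for the inverse.
  refine denom_div_eval_ne_zero_of_bounded hdet0 2 (fun ω => ?_) ω
  rw [eval_sub, two_mul]
  refine (norm_sub_le _ _).trans (add_le_add ?_ (hbound i j ω))
  by_cases hij : i = j <;> simp [hij, one_apply]

/-! ### State space: removing a common kernel by feedback -/

/-- If `ker M ∩ ker C = 0` and `ker Mᴴ ∩ ker Bᴴ = 0`, then some `M + B K C` is invertible. -/
theorem exists_gain_det_ne_zero {n p : ℕ} (B : Matrix (Fin n) (Fin p) ℂ)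
    (C : Matrix (Fin p) (Fin n) ℂ) (k : ℕ) : ∀ M : Matrix (Fin n) (Fin n) ℂ,
    Module.finrank ℂ (LinearMap.ker M.mulVecLin) ≤ k →
    (∀ x, M *ᵥ x = 0 → C *ᵥ x = 0 → x = 0) → (∀ y, Mᴴ *ᵥ y = 0 → Bᴴ *ᵥ y = 0 → y = 0) →
    ∃ K : Matrix (Fin p) (Fin p) ℂ, (M + B * K * C).det ≠ 0 := by
  induction k with
  | zero =>
    intro M hk _ _
    refine ⟨0, fun h0 => ?_⟩
    rw [Matrix.mul_zero, Matrix.zero_mul, add_zero] at h0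
    obtain ⟨x, hx, hMx⟩ := exists_mulVec_eq_zero_iff.2 h0
    have : LinearMap.ker M.mulVecLin = ⊥ :=
      Submodule.finrank_eq_zero.1 (Nat.le_zero.1 hk)
    exact hx ((Submodule.mem_bot ℂ).1 (this ▸ (by simpa using hMx)))
  | succ k ih =>
    intro M hk hC hB
    by_cases h0 : M.det = 0
    swap
    · exact ⟨0, by simpa using h0⟩
    obtain ⟨x, hx, hMx⟩ := exists_mulVec_eq_zero_iff.2 h0
    obtain ⟨y, hy, hMy⟩ := exists_mulVec_eq_zero_iff.2
      (show Mᴴ.det = 0 by rw [det_conjTranspose, h0, star_zero])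
    set w := C *ᵥ x with hw
    set v := Bᴴ *ᵥ y with hv
    have hw0 : w ≠ 0 := fun h => hx (hC x hMx h)
    have hv0 : v ≠ 0 := fun h => hy (hB y hMy h)
    -- This gain sends `x` to a nonzero multiple of `B v`, which is outside the range of `M` since
    -- `y` annihilates the range and `yᴴ B v = ‖v‖² ≠ 0`. Hence the kernel shrinks and loses `x`.
    set K₁ : Matrix (Fin p) (Fin p) ℂ := vecMulVec v (star w) with hK₁
    have hact : ∀ z, (M + B * K₁ * C) *ᵥ z = M *ᵥ z + (star w ⬝ᵥ C *ᵥ z) • (B *ᵥ v) := by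
      intro z
      rw [add_mulVec, ← mulVec_mulVec, ← mulVec_mulVec, hK₁, vecMulVec_mulVec]
      simp [mulVec_smul]
    have hker : ∀ z, (M + B * K₁ * C) *ᵥ z = 0 → M *ᵥ z = 0 ∧ star w ⬝ᵥ C *ᵥ z = 0 := by
      intro z hz
      rw [hact] at hz
      have h1 := congrArg (fun u => star y ⬝ᵥ u) hz
      have hyM : star y ⬝ᵥ M *ᵥ z = 0 := by
        rw [dotProduct_mulVec, ← conjTranspose_conjTranspose M, ← star_mulVec, hMy]; simp
      have hyB : star y ⬝ᵥ B *ᵥ v = star v ⬝ᵥ v := by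
        rw [dotProduct_mulVec, hv, star_mulVec, conjTranspose_conjTranspose]
      simp only [dotProduct_add, dotProduct_smul, hyM, hyB, zero_add, dotProduct_zero,
        smul_eq_mul, mul_eq_zero, dotProduct_star_self_eq_zero] at h1
      have h2 : star w ⬝ᵥ C *ᵥ z = 0 := by
        rcases h1 with h1 | h1
        · exact h1
        · exact absurd h1 hv0
      refine ⟨?_, h2⟩
      rwa [h2, zero_smul, add_zero] at hz
    have hlt : LinearMap.ker (M + B * K₁ * C).mulVecLin < LinearMap.ker M.mulVecLin := by
      refine lt_of_le_of_ne (fun z hz => by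
        simpa using (hker z (by simpa only [LinearMap.mem_ker, mulVecLin_apply] using hz)).1)
        fun he => ?_
      have hxm : x ∈ LinearMap.ker (M + B * K₁ * C).mulVecLin := by
        rw [he]; simpa using hMx
      exact hw0 (dotProduct_star_self_eq_zero.1 (hker x
        (by simpa only [LinearMap.mem_ker, mulVecLin_apply] using hxm)).2)
    have hfr := Submodule.finrank_lt_finrank_of_lt hlt
    obtain ⟨K₂, hK₂⟩ := ih (M + B * K₁ * C) (by omega)
      (fun z hz hCz => hC z (hker z hz).1 hCz)
      (fun z hz hBz => by
        refine hB z ?_ hBz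
        rw [conjTranspose_add, conjTranspose_mul, conjTranspose_mul, add_mulVec,
          ← mulVec_mulVec, ← mulVec_mulVec, hBz] at hz
        simpa using hz)
    refine ⟨K₁ + K₂, ?_⟩
    rwa [Matrix.mul_add, Matrix.add_mul, ← add_assoc]

/-! ### State space: imaginary eigenvalues of the even closed loop -/

theorem mem_spectrum_iff_exists_mulVec {ι : Type*} [Fintype ι] [DecidableEq ι]
    (M : Matrix ι ι ℂ) (z : ℂ) : z ∈ spectrum ℂ M ↔ ∃ v ≠ 0, M *ᵥ v = z • v := by
  rw [spectrum.mem_iff, isUnit_iff_isUnit_det, isUnit_iff_ne_zero, not_not,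
    ← exists_mulVec_eq_zero_iff]
  refine exists_congr fun v => and_congr_right fun _ => ?_
  rw [sub_mulVec, Algebra.algebraMap_eq_smul_one, smul_mulVec, one_mulVec, sub_eq_zero, eq_comm]

theorem evenClosedLoopState_eq {n p m : ℕ} (A : Matrix (Fin n) (Fin n) ℂ)
    (B : Matrix (Fin n) (Fin m) ℂ) (C : Matrix (Fin p) (Fin n) ℂ) (K : Matrix (Fin p) (Fin p) ℂ) :
    evenClosedLoopState A B C K = fromBlocks A (B * Bᴴ) (-(Cᴴ * K * C)) (-Aᴴ) := by
  rw [evenClosedLoopState, Matrix.fromRows_mul, fromRows_mul_fromCols, fromBlocks_add]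
  simp

theorem evenClosedLoopState_mulVec {n p m : ℕ} (A : Matrix (Fin n) (Fin n) ℂ)
    (B : Matrix (Fin n) (Fin m) ℂ) (C : Matrix (Fin p) (Fin n) ℂ) (K : Matrix (Fin p) (Fin p) ℂ)
    (x y : Fin n → ℂ) :
    evenClosedLoopState A B C K *ᵥ Sum.elim x y =
      Sum.elim (A *ᵥ x + B *ᵥ Bᴴ *ᵥ y) (-(Cᴴ *ᵥ K *ᵥ C *ᵥ x) - Aᴴ *ᵥ y) := by
  rw [evenClosedLoopState_eq, fromBlocks_mulVec]
  simp [neg_mulVec, ← mulVec_mulVec, sub_eq_add_neg]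

/-- An imaginary eigenvalue of the even closed loop with gain `-I` belongs to an unobservable or
an uncontrollable mode. -/
theorem evenClosedLoopState_neg_one_eigenvector {n p m : ℕ} {A : Matrix (Fin n) (Fin n) ℂ}
    {B : Matrix (Fin n) (Fin m) ℂ} {C : Matrix (Fin p) (Fin n) ℂ} {ω : ℝ} {x y : Fin n → ℂ}
    (h : evenClosedLoopState A B C (-1) *ᵥ Sum.elim x y = ((ω : ℂ) * Complex.I) • Sum.elim x y) :
    (A *ᵥ x = ((ω : ℂ) * Complex.I) • x ∧ C *ᵥ x = 0) ∧
      (Aᴴ *ᵥ y = -((ω : ℂ) * Complex.I) • y ∧ Bᴴ *ᵥ y = 0) := by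
  rw [evenClosedLoopState_mulVec] at h
  set z := (ω : ℂ) * Complex.I with hz
  have hx : A *ᵥ x + B *ᵥ Bᴴ *ᵥ y = z • x := by
    ext i; simpa using congrFun h (Sum.inl i)
  have hy : Cᴴ *ᵥ C *ᵥ x - Aᴴ *ᵥ y = z • y := by
    ext i; simpa [neg_mulVec, mulVec_neg] using congrFun h (Sum.inr i)
  have h1 := congrArg (fun u => star y ⬝ᵥ u) hx
  have h2 := congrArg (fun u => star u ⬝ᵥ x) hy
  have hBB : star y ⬝ᵥ B *ᵥ Bᴴ *ᵥ y = star (Bᴴ *ᵥ y) ⬝ᵥ Bᴴ *ᵥ y := by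
    rw [star_mulVec, conjTranspose_conjTranspose, dotProduct_mulVec]
  have hCC : star (Cᴴ *ᵥ C *ᵥ x) ⬝ᵥ x = star (C *ᵥ x) ⬝ᵥ C *ᵥ x := by
    rw [star_mulVec, conjTranspose_conjTranspose, dotProduct_mulVec]
  have hAA : star (Aᴴ *ᵥ y) ⬝ᵥ x = star y ⬝ᵥ A *ᵥ x := by
    rw [star_mulVec, conjTranspose_conjTranspose, dotProduct_mulVec]
  have hzs : star z = -z := by simp [hz]
  simp only [dotProduct_add, dotProduct_smul, hBB, smul_eq_mul] at h1
  simp only [star_sub, sub_dotProduct, star_smul, smul_dotProduct, hCC, hAA, hzs,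
    smul_eq_mul] at h2
  -- Since `conj z = -z`, the terms in `A` and `z` cancel, leaving `‖Bᴴ y‖² + ‖C x‖² = 0`.
  have hsum : star (Bᴴ *ᵥ y) ⬝ᵥ Bᴴ *ᵥ y + star (C *ᵥ x) ⬝ᵥ C *ᵥ x = 0 := by
    linear_combination h1 + h2
  have hB0 := dotProduct_star_self_nonneg (Bᴴ *ᵥ y)
  have hC0 := dotProduct_star_self_nonneg (C *ᵥ x)
  obtain ⟨hB, hC⟩ := (add_eq_zero_iff_of_nonneg hB0 hC0).1 hsum
  have hB' : Bᴴ *ᵥ y = 0 := dotProduct_star_self_eq_zero.1 hB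
  have hC' : C *ᵥ x = 0 := dotProduct_star_self_eq_zero.1 hC
  rw [hB', mulVec_zero, add_zero] at hx
  rw [hC', mulVec_zero, zero_sub] at hy
  exact ⟨⟨hx, hC'⟩, by rw [neg_smul, ← hy, neg_neg], hB'⟩

/-- Feedback acts only through `C x` and `Bᴴ y`, so an eigenvector annihilated by `C`, or a left one
annihilated by `Bᴴ`, persists in every `A + B K C`. -/
theorem noImagSpectrum_evenClosedLoopState_neg_one {n p : ℕ} {A : Matrix (Fin n) (Fin n) ℂ}
    {B : Matrix (Fin n) (Fin p) ℂ} {C : Matrix (Fin p) (Fin n) ℂ} {K : Matrix (Fin p) (Fin p) ℂ}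
    (h : NoImagSpectrum (A + B * K * C)) : NoImagSpectrum (evenClosedLoopState A B C (-1)) := by
  intro ω hω
  obtain ⟨v, hv, hHv⟩ := (mem_spectrum_iff_exists_mulVec _ _).1 hω
  obtain ⟨x, y, rfl⟩ : ∃ x y, v = Sum.elim x y :=
    ⟨v ∘ Sum.inl, v ∘ Sum.inr, (Sum.elim_comp_inl_inr v).symm⟩
  obtain ⟨⟨hx, hC⟩, hy, hB⟩ := evenClosedLoopState_neg_one_eigenvector hHv
  have hx0 : x = 0 := by
    by_contra hx0
    refine h ω ((mem_spectrum_iff_exists_mulVec _ _).2 ⟨x, hx0, ?_⟩)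
    rw [add_mulVec, ← mulVec_mulVec, hC, mulVec_zero, add_zero, hx]
  have hy0 : y = 0 := by
    by_contra hy0
    refine h ω ?_
    have h1 : (ω : ℂ) * Complex.I ∈ spectrum ℂ (-(A + B * K * C)ᴴ) := by
      refine (mem_spectrum_iff_exists_mulVec _ _).2 ⟨y, hy0, ?_⟩
      rw [conjTranspose_add, conjTranspose_mul, neg_mulVec, add_mulVec, conjTranspose_mul,
        ← mulVec_mulVec, ← mulVec_mulVec, hB, hy]
      simp
    simpa using spectrum_neg_conjTranspose h1
  refine hv ?_
  rw [hx0, hy0]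
  ext (i | i) <;> rfl

theorem exists_noImagSpectrum_of_evenClosedLoopState {n p : ℕ} {A : Matrix (Fin n) (Fin n) ℂ}
    {B : Matrix (Fin n) (Fin p) ℂ} {C : Matrix (Fin p) (Fin n) ℂ} {L : Matrix (Fin p) (Fin p) ℂ}
    (h : NoImagSpectrum (evenClosedLoopState A B C L)) :
    ∃ K : Matrix (Fin p) (Fin p) ℂ, NoImagSpectrum (A + B * K * C) := by
  obtain ⟨f, hf, hdvd, hz⟩ := exists_monic_gcd_charpoly_feedback A B C
  obtain ⟨K, hK⟩ := exists_gain_no_imaginary_root hf hdvd hz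
  refine ⟨K, fun ω hω => ?_⟩
  set z := (ω : ℂ) * Complex.I with hzdef
  have hpair : ∀ x y, evenClosedLoopState A B C L *ᵥ Sum.elim x y = z • Sum.elim x y →
      x = 0 ∧ y = 0 := fun x y hxy => by
    by_contra hne
    refine h ω ((mem_spectrum_iff_exists_mulVec _ _).2 ⟨Sum.elim x y, fun h0 => hne ?_, hxy⟩)
    exact ⟨funext fun i => congrFun h0 (Sum.inl i), funext fun i => congrFun h0 (Sum.inr i)⟩
  have hzs : star z = -z := by simp [hzdef]
  -- An unobservable `x` or an uncontrollable `y` at `z` would give the eigenvector `(x, 0)` or `(0,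
  -- y)` of the even system, whatever its gain.
  obtain ⟨K₀, hK₀⟩ := exists_gain_det_ne_zero B C _ (A - z • 1) le_rfl
    (fun x hx hC => by
      refine (hpair x 0 ?_).1
      rw [sub_mulVec, smul_mulVec, one_mulVec, sub_eq_zero] at hx
      rw [evenClosedLoopState_mulVec, hx, hC]
      ext (i | i) <;> simp)
    (fun y hy hB => by
      refine (hpair 0 y ?_).2
      rw [conjTranspose_sub, conjTranspose_smul, conjTranspose_one, hzs, sub_mulVec, smul_mulVec,
        one_mulVec, sub_eq_zero] at hy
      rw [evenClosedLoopState_mulVec, hy, hB]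
      ext (i | i) <;> simp)
  rw [mem_spectrum_iff_isRoot_charpoly, IsRoot] at hω
  obtain ⟨q, hq⟩ := hdvd K
  have hKω := hK ω
  rw [hq, mul_divByMonic_cancel_left _ hf] at hKω
  -- The imaginary eigenvalue must be a root of `f`, hence an eigenvalue for every gain, including
  -- `K₀`.
  rw [hq, eval_mul, mul_eq_zero, or_iff_left hKω] at hω
  obtain ⟨q₀, hq₀⟩ := hdvd K₀
  have hroot : z ∈ spectrum ℂ (A + B * K₀ * C) := by
    rw [mem_spectrum_iff_isRoot_charpoly, IsRoot, hq₀, eval_mul, hω, zero_mul]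
  obtain ⟨v, hv, hAv⟩ := (mem_spectrum_iff_exists_mulVec _ _).1 hroot
  refine hK₀ (exists_mulVec_eq_zero_iff.1 ⟨v, hv, ?_⟩)
  rw [sub_add_eq_add_sub, sub_mulVec, hAv, smul_mulVec, one_mulVec, sub_self]

end

theorem mainTheorem9 (n p : ℕ)
    (A : Matrix (Fin n) (Fin n) ℂ) (B : Matrix (Fin n) (Fin p) ℂ) (C : Matrix (Fin p) (Fin n) ℂ)
    (hrank : B.rank = C.rank)
    (G : Matrix (Fin p) (Fin p) (RatFunc ℂ)) (hG : G = transferFunction A B C) :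
    ((∃ K : Matrix (Fin p) (Fin p) ℂ, IsAnalyticOnImagAxis (closedLoop G K)) ↔
      ∃ K : Matrix (Fin p) (Fin p) ℂ, (-K).PosSemidef ∧
        IsAnalyticOnImagAxis (closedLoop (G * ratMatrixSharp G) K)) ∧
    ((∃ K : Matrix (Fin p) (Fin p) ℂ, NoImagSpectrum (A + B * K * C)) ↔
      ∃ K : Matrix (Fin p) (Fin p) ℂ, (-K).PosSemidef ∧
        NoImagSpectrum (evenClosedLoopState A B C K)) := by
  have hpsd : (-(-1 : Matrix (Fin p) (Fin p) ℂ)).PosSemidef := by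
    rw [neg_neg]; exact PosSemidef.one
  subst hG
  refine ⟨⟨fun _ => ⟨-1, hpsd, isAnalyticOnImagAxis_closedLoop_mul_sharp A B C⟩,
    fun _ => exists_isAnalyticOnImagAxis_closedLoop A B C⟩,
    ⟨fun ⟨_, hK⟩ => ⟨-1, hpsd, noImagSpectrum_evenClosedLoopState_neg_one hK⟩,
    fun ⟨_, _, hL⟩ => exists_noImagSpectrum_of_evenClosedLoopState hL⟩⟩
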